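/- Let $K$ be an infinite field and let $R=K[x_1,\dots,x_n]$ be the polynomial ring. Let $V=(V_1,\dots,V_m)$ be any collection of $K$-vector subspaces of the space $R_1=\langle x_1,\dots,x_n\rangle_K$ of linear forms of $R$, and let $A(V)$ be the $K$-subalgebra of $R$ generated by the elements of the product $V_1\cdots V_m$, that is, by the products $f_1\cdots f_m$ with $f_i\in V_i$ for $i=1,\dots,m$. Then $A(V)$ is normal, i.e. it is a domain that is integrally closed in its field of fractions. -/

import Mathlib

/-- Given a collection `V 0, …, V (m - 1)` of `K`-subspaces of the polynomial ring
`R = K[x_1, …, x_n]`, this is the `K`-subalgebra of `R` generated by the elements of the product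
`V 0 ⋯ V (m - 1)`. The product is that of `K`-subspaces of `R`, that is, the `K`-span of all
products `f_0 ⋯ f_(m - 1)` with `f_i ∈ V i`. -/
noncomputable def productAlgebra (K : Type*) [Field K] {n m : ℕ}
    (V : Fin m → Submodule K (MvPolynomial (Fin n) K)) :
    Subalgebra K (MvPolynomial (Fin n) K) :=
  Algebra.adjoin K ((∏ i, V i : Submodule K (MvPolynomial (Fin n) K)) :
    Set (MvPolynomial (Fin n) K))

/-! For a space `T` of linear forms, the largest `a` with `f ∈ (T)^a` is a valuation
(`mem_spanIdeal_pow_iff`). Over an infinite field, a product of `N` spaces of linear forms is cut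
out among forms of degree `N` by lower bounds on the orders along partial sums of the spaces
(`mem_prod_of_forall_mem_spanIdeal_pow`).

Since `R` is integrally closed, it suffices to treat `f ∈ R` that is integral over `A(V)` and a
quotient of its elements. Valuation bounds pass to integral elements, so the component of `f` of
degree `m * k` has order at least `|A| * k` along the sum of the `V i`, `i ∈ A`. By the criterion
for `k` copies of each `V i`, it lies in `(∏ i, V i) ^ k`. Components in other degrees vanish, as
`A(V)` lives in degrees divisible by `m`. -/

namespace LinearProducts

open MvPolynomial

/-! ### Order along a space of linear forms -/

section Order

variable {K σ : Type*} [Field K]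

/-- An algebra homomorphism acts on linear forms as any linear map with which it agrees on the
variables. -/
lemma algHom_eq_of_linear {S : Type*} [CommRing S] [Algebra K S]
    (φ : MvPolynomial σ K →ₐ[K] S) (l : MvPolynomial σ K →ₗ[K] S)
    (h : ∀ i, φ (X i) = l (X i)) {v : MvPolynomial σ K} (hv : v.IsHomogeneous 1) : φ v = l v := by
  have hv' : v ∈ homogeneousSubmodule σ K 1 := hv
  rw [homogeneousSubmodule_one_eq_span_X] at hv'
  clear hv
  induction hv' using Submodule.span_induction with
  | mem x hx => obtain ⟨i, rfl⟩ := hx; exact h i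
  | zero => simp
  | add x y _ _ hx hy => simp [hx, hy]
  | smul c x _ hx => simp [hx]

lemma exists_projection {M : Type*} [AddCommGroup M] [Module K M] (T : Submodule K M) :
    ∃ p : M →ₗ[K] M, (∀ x, p x ∈ T) ∧ ∀ x ∈ T, p x = x := by
  obtain ⟨g, hg⟩ := T.subtype.exists_leftInverse_of_injective T.ker_subtype
  refine ⟨T.subtype ∘ₗ g, fun x => (g x).2, fun x hx => ?_⟩
  have := LinearMap.congr_fun hg ⟨x, hx⟩
  simpa using congrArg Subtype.val this

/-- A chosen linear projection onto a subspace. -/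
noncomputable def proj {M : Type*} [AddCommGroup M] [Module K M] (T : Submodule K M) :
    M →ₗ[K] M :=
  (exists_projection T).choose

lemma proj_mem {M : Type*} [AddCommGroup M] [Module K M] (T : Submodule K M) (x : M) :
    proj T x ∈ T :=
  (exists_projection T).choose_spec.1 x

lemma proj_eq_self {M : Type*} [AddCommGroup M] [Module K M] {T : Submodule K M} {x : M}
    (hx : x ∈ T) : proj T x = x :=
  (exists_projection T).choose_spec.2 x hx

/-- The ideal generated by a subspace. -/
noncomputable def spanIdeal (T : Submodule K (MvPolynomial σ K)) : Ideal (MvPolynomial σ K) :=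
  Ideal.span (T : Set (MvPolynomial σ K))

lemma spanIdeal_mono {T T' : Submodule K (MvPolynomial σ K)} (h : T ≤ T') :
    spanIdeal T ≤ spanIdeal T' :=
  Ideal.span_mono h

lemma mem_spanIdeal {T : Submodule K (MvPolynomial σ K)} {x : MvPolynomial σ K} (hx : x ∈ T) :
    x ∈ spanIdeal T :=
  Ideal.subset_span hx

/-- The substitution multiplying the component along `T` of each linear form by `X`. It reads off
the order of a polynomial along `T`. -/
noncomputable def orderHom (T : Submodule K (MvPolynomial σ K)) :
    MvPolynomial σ K →ₐ[K] Polynomial (MvPolynomial σ K) :=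
  aeval fun i => Polynomial.C (X i - proj T (X i)) + Polynomial.X * Polynomial.C (proj T (X i))

lemma orderHom_linear (T : Submodule K (MvPolynomial σ K)) {v : MvPolynomial σ K}
    (hv : v.IsHomogeneous 1) :
    orderHom T v = Polynomial.C (v - proj T v) + Polynomial.X * Polynomial.C (proj T v) := by
  let l : MvPolynomial σ K →ₗ[K] Polynomial (MvPolynomial σ K) :=
    (Polynomial.CAlgHom (R := K)).toLinearMap ∘ₗ (LinearMap.id - proj T) +
      LinearMap.mulLeft K Polynomial.X ∘ₗ (Polynomial.CAlgHom (R := K)).toLinearMap ∘ₗ proj T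
  have := algHom_eq_of_linear (orderHom T) l (fun i => by simp [orderHom, l]) hv
  simpa [l] using this

lemma eval_one_orderHom (T : Submodule K (MvPolynomial σ K)) (f : MvPolynomial σ K) :
    (orderHom T f).eval 1 = f := by
  have : ((Polynomial.aeval (R := MvPolynomial σ K) (1 : MvPolynomial σ K)).restrictScalars K).comp
      (orderHom T) = AlgHom.id K _ := by
    ext i : 1
    simp [orderHom]
  simpa [Polynomial.coe_aeval_eq_eval] using DFunLike.congr_fun this f

lemma orderHom_mem_reesAlgebra (T : Submodule K (MvPolynomial σ K)) (f : MvPolynomial σ K) :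
    orderHom T f ∈ reesAlgebra (spanIdeal T) := by
  suffices h : (orderHom T).range ≤ (reesAlgebra (spanIdeal T)).restrictScalars K from
    h ⟨f, rfl⟩
  rw [orderHom, aeval_range, Algebra.adjoin_le_iff]
  rintro _ ⟨i, rfl⟩
  refine add_mem ?_ ?_
  · exact (reesAlgebra (spanIdeal T)).algebraMap_mem _
  · have := reesAlgebra.monomial_mem (I := spanIdeal T) (i := 1) (r := proj T (X i))
    rw [pow_one] at this
    rw [← pow_one Polynomial.X, Polynomial.X_pow_mul_C, Polynomial.C_mul_X_pow_eq_monomial]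
    exact this.2 (mem_spanIdeal (proj_mem T _))

/-- Elements of `T` become multiples of `X`. Conversely, the coefficient of `X ^ b` lies in the
`b`-th power of the ideal, and evaluating at `1` recovers `f` as the sum of the coefficients. -/
lemma mem_spanIdeal_pow_iff {T : Submodule K (MvPolynomial σ K)}
    (hT : T ≤ homogeneousSubmodule σ K 1) {a : ℕ} {f : MvPolynomial σ K} :
    f ∈ spanIdeal T ^ a ↔ Polynomial.X ^ a ∣ orderHom T f := by
  constructor
  · intro hf
    have h1 : (spanIdeal T).map (orderHom T) ≤ Ideal.span {Polynomial.X} := by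
      rw [spanIdeal, Ideal.map_span, Ideal.span_le]
      rintro _ ⟨v, hv, rfl⟩
      simp only [SetLike.mem_coe]
      rw [Ideal.mem_span_singleton, orderHom_linear T (hT hv), proj_eq_self hv]
      simp
    have h2 := Ideal.mem_map_of_mem (orderHom T) hf
    rw [Ideal.map_pow] at h2
    have h3 := Ideal.pow_right_mono h1 a h2
    rwa [Ideal.span_singleton_pow, Ideal.mem_span_singleton] at h3
  · intro hf
    rw [Polynomial.X_pow_dvd_iff] at hf
    rw [← eval_one_orderHom T f, Polynomial.eval_eq_sum_range]
    refine Ideal.sum_mem _ fun b _ => ?_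
    rw [one_pow, mul_one]
    by_cases hb : b < a
    · rw [hf b hb]; exact zero_mem _
    · exact Ideal.pow_le_pow_right (not_lt.1 hb)
        ((mem_reesAlgebra_iff _ _).1 (orderHom_mem_reesAlgebra T f) b)

/-- A linear form outside `T` has order zero, and `X` is prime. -/
lemma mem_spanIdeal_pow_of_mul {T : Submodule K (MvPolynomial σ K)}
    (hT : T ≤ homogeneousSubmodule σ K 1) {a : ℕ} {x h : MvPolynomial σ K}
    (hx : x.IsHomogeneous 1) (hxT : x ∉ T) (hxh : x * h ∈ spanIdeal T ^ a) :
    h ∈ spanIdeal T ^ a := by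
  rw [mem_spanIdeal_pow_iff hT] at hxh ⊢
  rw [map_mul] at hxh
  refine Polynomial.prime_X.pow_dvd_of_dvd_mul_left a ?_ hxh
  rw [Polynomial.X_dvd_iff, orderHom_linear T hx]
  intro h0
  simp only [Polynomial.coeff_add, Polynomial.coeff_C_zero, Polynomial.mul_coeff_zero,
    Polynomial.coeff_X_zero, zero_mul, add_zero] at h0
  rw [sub_eq_zero] at h0
  exact hxT (h0 ▸ proj_mem T x)

/-- A nonzero linear form has order at most one. -/
lemma mem_spanIdeal_pow_of_mul_succ {T : Submodule K (MvPolynomial σ K)}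
    (hT : T ≤ homogeneousSubmodule σ K 1) {a : ℕ} {x h : MvPolynomial σ K}
    (hx : x.IsHomogeneous 1) (hx0 : x ≠ 0) (hxh : x * h ∈ spanIdeal T ^ (a + 1)) :
    h ∈ spanIdeal T ^ a := by
  by_cases hxT : x ∈ T
  · rw [mem_spanIdeal_pow_iff hT] at hxh ⊢
    rw [map_mul, orderHom_linear T hx, proj_eq_self hxT, sub_self, map_zero, zero_add, mul_assoc,
      pow_succ', mul_dvd_mul_iff_left Polynomial.X_ne_zero] at hxh
    refine Polynomial.prime_X.pow_dvd_of_dvd_mul_left a ?_ hxh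
    rw [Polynomial.X_dvd_iff]
    simpa using hx0
  · exact Ideal.pow_le_pow_right (Nat.le_succ a) (mem_spanIdeal_pow_of_mul hT hx hxT hxh)

end Order

/-! ### Reduction modulo a linear form -/

section Quotient

variable {K σ : Type*} [Field K]

/-- The substitution killing the linear form `x`, by projecting linear forms along `x`. -/
noncomputable def killHom (x : MvPolynomial σ K) : MvPolynomial σ K →ₐ[K] MvPolynomial σ K :=
  aeval fun i => X i - proj (K ∙ x) (X i)

lemma killHom_linear (x : MvPolynomial σ K) {v : MvPolynomial σ K} (hv : v.IsHomogeneous 1) :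
    killHom x v = v - proj (K ∙ x) v := by
  rw [algHom_eq_of_linear (killHom x) (LinearMap.id - proj (K ∙ x)) (fun i => by simp [killHom]) hv]
  rfl

lemma killHom_self {x : MvPolynomial σ K} (hx : x.IsHomogeneous 1) : killHom x x = 0 := by
  rw [killHom_linear x hx, proj_eq_self (Submodule.mem_span_singleton_self x), sub_self]

lemma killHom_isHomogeneous {x : MvPolynomial σ K} (hx : x.IsHomogeneous 1)
    {f : MvPolynomial σ K} {d : ℕ} (hf : f.IsHomogeneous d) : (killHom x f).IsHomogeneous d := by
  have := hf.aeval (fun i => X i - proj (K ∙ x) (X i)) (n := 1) fun i => by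
    refine (isHomogeneous_X K i).sub ?_
    have : K ∙ x ≤ homogeneousSubmodule σ K 1 := by
      rw [Submodule.span_singleton_le_iff_mem]; exact hx
    exact this (proj_mem _ _)
  rwa [one_mul] at this

lemma dvd_sub_killHom (x f : MvPolynomial σ K) : x ∣ f - killHom x f := by
  rw [← Ideal.mem_span_singleton, ← Ideal.Quotient.eq]
  have : Ideal.Quotient.mkₐ K (Ideal.span {x}) =
      (Ideal.Quotient.mkₐ K (Ideal.span {x})).comp (killHom x) := by
    ext i
    obtain ⟨c, hc⟩ := Submodule.mem_span_singleton.1 (proj_mem (K ∙ x) (X i))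
    simp only [Ideal.Quotient.mkₐ_eq_mk, AlgHom.comp_apply]
    rw [Ideal.Quotient.eq, killHom, aeval_X, sub_sub_cancel, ← hc, smul_eq_C_mul]
    exact Ideal.mul_mem_left _ _ (Ideal.mem_span_singleton_self x)
  exact DFunLike.congr_fun this f

lemma dvd_of_killHom_eq_zero {x f : MvPolynomial σ K} (hf : killHom x f = 0) : x ∣ f := by
  simpa [hf] using dvd_sub_killHom x f

/-- If a linear form divides a homogeneous polynomial, the quotient can be taken homogeneous. -/
lemma exists_isHomogeneous_of_dvd {x f : MvPolynomial σ K} {d : ℕ} (hx : x.IsHomogeneous 1)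
    (hf : f.IsHomogeneous (d + 1)) (hxf : x ∣ f) :
    ∃ h : MvPolynomial σ K, h.IsHomogeneous d ∧ f = x * h := by
  obtain ⟨h, rfl⟩ := hxf
  refine ⟨homogeneousComponent d h, homogeneousComponent_isHomogeneous d h, ?_⟩
  have h1 : homogeneousComponent (d + 1) (x * h) = x * homogeneousComponent d h := by
    conv_lhs => rw [← sum_homogeneousComponent h, Finset.mul_sum, map_sum]
    have h2 : ∀ i, homogeneousComponent (d + 1) (x * homogeneousComponent i h) =
        if i = d then x * homogeneousComponent d h else 0 := fun i => by
      have h3 : x * homogeneousComponent i h ∈ homogeneousSubmodule σ K (i + 1) := by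
        rw [add_comm]
        exact hx.mul (homogeneousComponent_isHomogeneous i h)
      rw [homogeneousComponent_of_mem h3]
      by_cases hid : i = d
      · simp [hid]
      · rw [if_neg (by omega), if_neg hid]
    simp_rw [h2]
    rw [Finset.sum_ite_eq']
    split_ifs with hd
    · rfl
    · rw [homogeneousComponent_eq_zero, mul_zero]
      simpa using hd
  rw [← h1, homogeneousComponent_of_mem hf, if_pos rfl]

end Quotient

/-! ### Products of spaces of linear forms -/

section Product

variable {K σ ι : Type*} [Field K]

lemma prod_le_homogeneousSubmodule {V : ι → Submodule K (MvPolynomial σ K)} {s : Finset ι}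
    (hV : ∀ i ∈ s, V i ≤ homogeneousSubmodule σ K 1) :
    ∏ i ∈ s, V i ≤ homogeneousSubmodule σ K s.card := by
  classical
  induction s using Finset.induction_on with
  | empty => simp [homogeneousSubmodule_zero]
  | insert i s hi ih =>
    rw [Finset.prod_insert hi, Finset.card_insert_of_notMem hi, add_comm]
    refine (mul_le_mul' (hV i (Finset.mem_insert_self i s))
      (ih fun j hj => hV j (Finset.mem_insert_of_mem hj))).trans ?_
    exact homogeneousSubmodule_mul 1 s.card

/-- The sum of the subspaces indexed by a finite set. -/
noncomputable def sumSpace (V : ι → Submodule K (MvPolynomial σ K)) (A : Finset ι) :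
    Submodule K (MvPolynomial σ K) :=
  ⨆ i ∈ A, V i

lemma sumSpace_mono (V : ι → Submodule K (MvPolynomial σ K)) {A B : Finset ι} (h : A ⊆ B) :
    sumSpace V A ≤ sumSpace V B :=
  biSup_mono h

lemma le_sumSpace (V : ι → Submodule K (MvPolynomial σ K)) {A : Finset ι} {i : ι} (hi : i ∈ A) :
    V i ≤ sumSpace V A :=
  le_iSup₂_of_le i hi le_rfl

lemma sumSpace_le {V : ι → Submodule K (MvPolynomial σ K)} {A : Finset ι}
    {T : Submodule K (MvPolynomial σ K)} (h : ∀ i ∈ A, V i ≤ T) : sumSpace V A ≤ T :=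
  iSup₂_le h

lemma mem_spanIdeal_pow_of_mem_prod {V : ι → Submodule K (MvPolynomial σ K)} {s A : Finset ι}
    (hA : A ⊆ s) {f : MvPolynomial σ K} (hf : f ∈ ∏ i ∈ s, V i) :
    f ∈ spanIdeal (sumSpace V A) ^ A.card := by
  classical
  suffices h : ∏ i ∈ s, V i ≤ (spanIdeal (sumSpace V A) ^ A.card).restrictScalars K from h hf
  have h1 : ∀ B ⊆ A, ∏ i ∈ B, V i ≤ (spanIdeal (sumSpace V A) ^ B.card).restrictScalars K := by
    intro B
    induction B using Finset.induction_on with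
    | empty => intro _ y _; simp
    | insert i B hi ih =>
      intro hB
      rw [Finset.prod_insert hi, Finset.card_insert_of_notMem hi, Submodule.mul_le]
      intro x hx y hy
      rw [Submodule.restrictScalars_mem, pow_succ']
      exact Ideal.mul_mem_mul
        (mem_spanIdeal (le_sumSpace V (hB (Finset.mem_insert_self i B)) hx))
        (ih (fun j hj => hB (Finset.mem_insert_of_mem hj)) hy)
  rw [← Finset.prod_sdiff hA, Submodule.mul_le]
  intro x _ y hy
  exact Ideal.mul_mem_left _ _ (h1 A subset_rfl hy)

/-- Over an infinite field, a subspace contains an element outside finitely many given subspaces,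
none of which contains it. -/
lemma exists_mem_forall_notMem [Infinite K] {M : Type*} [AddCommGroup M] [Module K M]
    (T : Submodule K M) (S : Finset (Submodule K M)) (hS : ∀ p ∈ S, ¬ T ≤ p) :
    ∃ x ∈ T, ∀ p ∈ S, x ∉ p := by
  classical
  have h := Subspace.biUnion_ne_univ_of_top_notMem (k := K) (E := T)
    (s := S.image fun p => p.comap T.subtype) (by
      rw [Finset.mem_image]
      rintro ⟨p, hp, hpt⟩
      exact hS p hp (Submodule.comap_subtype_eq_top.1 hpt))
  rw [Ne, Set.eq_univ_iff_forall, not_forall] at h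
  obtain ⟨x, hx⟩ := h
  refine ⟨x, x.2, fun p hp hxp => hx ?_⟩
  simp only [Finset.mem_image, Set.mem_iUnion]
  exact ⟨p.comap T.subtype, ⟨p, hp, rfl⟩, hxp⟩

lemma map_prod_submodule {A B : Type*} [CommRing A] [CommRing B] [Algebra K A] [Algebra K B]
    (φ : A →ₐ[K] B) (s : Finset ι) (V : ι → Submodule K A) :
    (∏ i ∈ s, V i).map φ.toLinearMap = ∏ i ∈ s, (V i).map φ.toLinearMap := by
  classical
  induction s using Finset.induction_on with
  | empty => simp [Submodule.map_one]
  | insert i s hi ih => rw [Finset.prod_insert hi, Finset.prod_insert hi, Submodule.map_mul, ih]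

/-- A product of `N` spaces of linear forms consists of the forms of degree `N` lying in the
appropriate powers of the ideals generated by partial sums of these spaces. -/
theorem mem_prod_of_forall_mem_spanIdeal_pow [Infinite K] [Finite σ] (s : Finset ι)
    (V : ι → Submodule K (MvPolynomial σ K)) (hV : ∀ i ∈ s, V i ≤ homogeneousSubmodule σ K 1)
    {f : MvPolynomial σ K} (hf : f.IsHomogeneous s.card)
    (h : ∀ A ⊆ s, f ∈ spanIdeal (sumSpace V A) ^ A.card) : f ∈ ∏ i ∈ s, V i := by
  classical
  -- Outer induction on the number of factors, inner induction on the dimension of their sum.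
  obtain ⟨N, hN⟩ : ∃ N, s.card = N := ⟨_, rfl⟩
  induction N generalizing s V f with
  | zero =>
    obtain rfl := Finset.card_eq_zero.1 hN
    rw [Finset.prod_empty, ← homogeneousSubmodule_zero]
    exact hf
  | succ N ihN =>
  obtain ⟨r, hr⟩ : ∃ r, Module.finrank K (sumSpace V s) = r := ⟨_, rfl⟩
  induction r using Nat.strong_induction_on generalizing V f with
  | _ r ihr =>
  have hT : ∀ A ⊆ s, sumSpace V A ≤ homogeneousSubmodule σ K 1 := fun A hA =>
    sumSpace_le fun i hi => hV i (hA hi)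
  by_cases hbot : sumSpace V s = ⊥
  · have h0 := h s subset_rfl
    have : spanIdeal (⊥ : Submodule K (MvPolynomial σ K)) = ⊥ := by simp [spanIdeal]
    rw [hbot, this, hN, Ideal.bot_pow (Nat.succ_ne_zero N), Ideal.mem_bot] at h0
    rw [h0]
    exact zero_mem _
  -- A general `x` in the total sum: nonzero, and outside every strictly smaller partial sum.
  obtain ⟨x, hxT, hx⟩ := exists_mem_forall_notMem (sumSpace V s)
    (insert ⊥ ((s.powerset.image (sumSpace V)).filter (fun p => p ≠ sumSpace V s))) (by
      intro p hp
      rw [Finset.mem_insert, Finset.mem_filter, Finset.mem_image] at hp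
      rcases hp with rfl | ⟨⟨A, hA, rfl⟩, hne⟩
      · rwa [le_bot_iff]
      · exact fun hle => hne (le_antisymm (sumSpace_mono V (Finset.mem_powerset.1 hA)) hle))
  have hx1 : x.IsHomogeneous 1 := hT s subset_rfl hxT
  have hx0 : x ≠ 0 := fun h0 => hx ⊥ (Finset.mem_insert_self _ _) (by simp [h0])
  have hxA : ∀ A ⊆ s, sumSpace V A ≠ sumSpace V s → x ∉ sumSpace V A := fun A hA hne =>
    hx _ (Finset.mem_insert_of_mem (Finset.mem_filter.2
      ⟨Finset.mem_image_of_mem _ (Finset.mem_powerset.2 hA), hne⟩))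
  set π := killHom x
  let V' : ι → Submodule K (MvPolynomial σ K) := fun i => (V i).map π.toLinearMap
  have hsum : ∀ A, sumSpace V' A = (sumSpace V A).map π.toLinearMap := fun A => by
    simp only [sumSpace, V', Submodule.map_iSup]
  have : FiniteDimensional K (sumSpace V s) := by
    have : FiniteDimensional K (homogeneousSubmodule σ K 1) :=
      Module.Finite.of_fg (homogeneousSubmodule_fg σ K 1)
    exact Submodule.finiteDimensional_of_le (hT s subset_rfl)
  have hrank : Module.finrank K (sumSpace V' s) < r := by
    rw [← hr, hsum, ← LinearMap.range_domRestrict,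
      ← LinearMap.finrank_range_add_finrank_ker (π.toLinearMap.domRestrict (sumSpace V s))]
    refine Nat.lt_add_of_pos_right (Submodule.one_le_finrank_iff.2 ?_)
    refine (Submodule.ne_bot_iff _).2 ⟨⟨x, hxT⟩, ?_, ?_⟩
    · simpa using killHom_self hx1
    · simpa [Subtype.ext_iff] using hx0
  -- Killing `x` lowers the dimension, so the inner induction applies modulo `x`. Lifting back gives
  -- `f = g + x * q` with `g` in the product.
  have hπf : π f ∈ ∏ i ∈ s, V' i := by
    refine ihr _ hrank V' ?_ (killHom_isHomogeneous hx1 hf) ?_ rfl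
    · rintro i hi _ ⟨v, hv, rfl⟩
      exact killHom_isHomogeneous hx1 (hV i hi hv)
    · intro A hA
      have h1 := Ideal.mem_map_of_mem π (h A hA)
      rw [Ideal.map_pow] at h1
      refine Ideal.pow_right_mono ?_ _ h1
      rw [spanIdeal, Ideal.map_span, Ideal.span_le, hsum]
      rintro _ ⟨v, hv, rfl⟩
      exact mem_spanIdeal (Submodule.mem_map_of_mem (f := π.toLinearMap) hv)
  rw [← map_prod_submodule] at hπf
  obtain ⟨g, hg, hgf⟩ := hπf
  have hg' : g.IsHomogeneous s.card := prod_le_homogeneousSubmodule hV hg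
  obtain ⟨q, hq, hfgq⟩ := exists_isHomogeneous_of_dvd (d := N) hx1 (f := f - g)
    (by rw [← hN]; exact hf.sub hg')
    (dvd_of_killHom_eq_zero (by
      rw [map_sub, sub_eq_zero]
      exact hgf.symm))
  have hxq : ∀ A ⊆ s, x * q ∈ spanIdeal (sumSpace V A) ^ A.card := fun A hA => by
    rw [← hfgq]
    exact sub_mem (h A hA) (mem_spanIdeal_pow_of_mem_prod hA hg)
  have hq_mem : ∀ j ∈ s, q ∈ ∏ i ∈ s.erase j, V i := by
    intro j hj
    have hcard : (s.erase j).card = N := by rw [Finset.card_erase_of_mem hj, hN]; rfl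
    refine ihN (s.erase j) V (fun i hi => hV i (Finset.mem_of_mem_erase hi))
      (by rwa [hcard]) (fun A hA => ?_) hcard
    have hAs : A ⊆ s := hA.trans (Finset.erase_subset j s)
    -- If `A` already spans the total sum, the bound `N + 1` for `s` applies; removing `x` costs at
    -- most one, and `A.card ≤ N`. Otherwise `x` has order zero along `A` and nothing is lost.
    by_cases hne : sumSpace V A = sumSpace V s
    · have h1 := hxq s subset_rfl
      rw [hN, ← hne] at h1
      refine Ideal.pow_le_pow_right ?_ (mem_spanIdeal_pow_of_mul_succ (hT A hAs) hx1 hx0 h1)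
      rw [← hcard]
      exact Finset.card_le_card hA
    · exact mem_spanIdeal_pow_of_mul (hT A hAs) hx1 (hxA A hAs hne) (hxq A hAs)
  -- `x` is a sum of elements of the `V j`, and `q` lies in each product omitting one factor.
  have hle : sumSpace V s ≤ (∏ i ∈ s, V i).comap (LinearMap.mulRight K q) :=
    sumSpace_le fun j hj v hv => by
      rw [Submodule.mem_comap, LinearMap.mulRight_apply, ← Finset.mul_prod_erase s V hj]
      exact Submodule.mul_mem_mul hv (hq_mem j hj)
  have hfin : f = g + x * q := by rw [← hfgq]; ring
  rw [hfin]
  exact add_mem hg (hle hxT)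

end Product

/-! ### Twisting a homomorphism by the degree -/

section Scaling

variable {K σ S : Type*} [Field K] [CommRing S] [Algebra K S]

/-- The homomorphism `φ` twisted by the grading: forms of degree `d` are multiplied by
`(c X) ^ d`. -/
noncomputable def scaledHom (c : S) (φ : MvPolynomial σ K →ₐ[K] S) :
    MvPolynomial σ K →ₐ[K] Polynomial S :=
  aeval fun i => Polynomial.monomial 1 (c * φ (X i))

lemma scaledHom_of_isHomogeneous (c : S) (φ : MvPolynomial σ K →ₐ[K] S) {d : ℕ}
    {f : MvPolynomial σ K} (hf : f.IsHomogeneous d) :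
    scaledHom c φ f = Polynomial.monomial d (c ^ d * φ f) := by
  have hf' : f ∈ homogeneousSubmodule σ K 1 ^ d := by
    rw [homogeneousSubmodule_one_pow]
    exact hf
  clear hf
  induction d generalizing f with
  | zero =>
    rw [pow_zero, Submodule.mem_one] at hf'
    obtain ⟨r, rfl⟩ := hf'
    rw [AlgHom.commutes, AlgHom.commutes, pow_zero, one_mul]
    rfl
  | succ d ih =>
    rw [pow_succ'] at hf'
    induction hf' using Submodule.mul_induction_on' with
    | mem_mul_mem v hv g hg =>
      have h1 : scaledHom c φ v = Polynomial.monomial 1 (c * φ v) :=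
        algHom_eq_of_linear (scaledHom c φ)
          ((Polynomial.monomial 1).restrictScalars K ∘ₗ LinearMap.mulLeft K c ∘ₗ φ.toLinearMap)
          (fun i => by simp [scaledHom]) hv
      rw [map_mul, h1, ih hg, Polynomial.monomial_mul_monomial, map_mul φ, add_comm 1 d]
      congr 1
      ring
    | add x _ y _ hx hy => rw [map_add, hx, hy, map_add, mul_add, map_add]

/-- The power of `X` records the degree, so integrality of `f` can be read on each component
separately. -/
lemma coeff_scaledHom (c : S) (φ : MvPolynomial σ K →ₐ[K] S) (f : MvPolynomial σ K) (d : ℕ) :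
    (scaledHom c φ f).coeff d = c ^ d * φ (homogeneousComponent d f) := by
  conv_lhs => rw [← sum_homogeneousComponent f, map_sum, Polynomial.finsetSum_coeff]
  simp_rw [scaledHom_of_isHomogeneous c φ (homogeneousComponent_isHomogeneous _ f),
    Polynomial.coeff_monomial]
  rw [Finset.sum_ite_eq']
  split_ifs with hd
  · rfl
  · rw [homogeneousComponent_eq_zero, map_zero, mul_zero]
    simpa using hd

end Scaling

/-! ### Integral elements and normality -/

section Integral

variable {K : Type*} [Field K] {n m : ℕ}

/-- An element integral over `A` is mapped by `φ : B → S[X]` to a polynomial with coefficients in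
the integrally closed domain `D`, if `φ` maps `A` to `D[X]`. -/
lemma coeff_mem_range_of_isIntegral {B D L : Type*} [CommRing B] [CommRing D]
    [IsDomain D] [IsIntegrallyClosed D] [Field L] [Algebra D L] [IsFractionRing D L] [Algebra K B]
    (A : Subalgebra K B) (φ : B →+* Polynomial L)
    (hφ : ∀ x ∈ A, ∃ y : Polynomial D, y.map (algebraMap D L) = φ x) {x : B}
    (hx : IsIntegral A x) (d : ℕ) : ∃ y : D, algebraMap D L y = (φ x).coeff d := by
  let : Algebra (Polynomial D) (Polynomial L) := Polynomial.algebra D L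
  let j := Polynomial.mapRingHom (algebraMap D L)
  have hj : Function.Injective j := Polynomial.map_injective _ (IsFractionRing.injective D L)
  -- Identifying `D[X]` with its image turns the preimages given by `hφ` into a ring homomorphism `A
  -- → D[X]`.
  let e := RingEquiv.ofBijective j.rangeRestrict
    ⟨fun a b h => hj (congrArg Subtype.val h), j.rangeRestrict_surjective⟩
  let ψ : A →+* j.range := (φ.comp A.val.toRingHom).codRestrict j.range fun x => hφ x x.2
  have h1 : IsIntegral (Polynomial D) (φ x) := by
    refine hx.map_of_comp_eq (e.symm.toRingHom.comp ψ) φ ?_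
    ext1 a
    exact congrArg Subtype.val (e.apply_symm_apply (ψ a))
  exact IsIntegrallyClosed.algebraMap_eq_of_integral (h1.coeff d)

/-- Generators have degree `m` and order at least `A.card`. Dividing forms of degree `d` by the
parameter to the power `A.card * d / m` keeps `A(V)` in polynomials, hence also every element
integral over it. -/
lemma homogeneousComponent_mem_spanIdeal_pow_of_isIntegral
    (V : Fin m → Submodule K (MvPolynomial (Fin n) K))
    (hV : ∀ i, V i ≤ homogeneousSubmodule (Fin n) K 1) {f : MvPolynomial (Fin n) K}
    (hf : IsIntegral (productAlgebra K V) f) (A : Finset (Fin m)) (k : ℕ) :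
    homogeneousComponent (m * k) f ∈ spanIdeal (sumSpace V A) ^ (A.card * k) := by
  -- For `m = 0` the exponent is `0`; `expand` below needs `m > 0` to preserve orders.
  rcases Nat.eq_zero_or_pos m with rfl | hm
  · have : A.card = 0 := by simp [Finset.eq_empty_of_isEmpty A]
    simp [this]
  have hT : sumSpace V A ≤ homogeneousSubmodule (Fin n) K 1 := sumSpace_le fun i _ => hV i
  set T := sumSpace V A
  let D := Polynomial (MvPolynomial (Fin n) K)
  let L := FractionRing D
  let τ : L := algebraMap D L Polynomial.X
  have hτ : τ ≠ 0 := by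
    rw [Ne, IsFractionRing.to_map_eq_zero_iff]
    exact Polynomial.X_ne_zero
  -- Replacing the parameter by its `m`-th power multiplies orders by `m` and avoids the fractional
  -- exponent `A.card / m`.
  let ρ : MvPolynomial (Fin n) K →ₐ[K] D :=
    ((Polynomial.expand (MvPolynomial (Fin n) K) m).restrictScalars K).comp (orderHom T)
  have hρ : ∀ g, ρ g = Polynomial.expand _ m (orderHom T g) := fun g => rfl
  let φ : MvPolynomial (Fin n) K →ₐ[K] L := (IsScalarTower.toAlgHom K D L).comp ρ
  have hφ : ∀ g, φ g = algebraMap D L (ρ g) := fun g => rfl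
  let c : L := (τ ^ A.card)⁻¹
  let Θ := scaledHom c φ
  have hΘ : ∀ x ∈ productAlgebra K V,
      ∃ y : Polynomial D, y.map (algebraMap D L) = Θ x := by
    suffices h : productAlgebra K V ≤
        (Polynomial.mapAlgHom (IsScalarTower.toAlgHom K D L)).range.comap Θ from
      fun x hx => h hx
    refine Algebra.adjoin_le fun x hx => ?_
    have hx1 : x.IsHomogeneous m := by
      simpa using prod_le_homogeneousSubmodule (s := Finset.univ) (fun i _ => hV i) hx
    have hx2 := mem_spanIdeal_pow_of_mem_prod (Finset.subset_univ A) hx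
    rw [mem_spanIdeal_pow_iff hT] at hx2
    obtain ⟨g, hg⟩ := hx2
    have hφx : φ x = (τ ^ m) ^ A.card * algebraMap D L (Polynomial.expand _ m g) := by
      rw [hφ, hρ, hg, map_mul (Polynomial.expand _ m), map_pow (Polynomial.expand _ m),
        Polynomial.expand_X, map_mul (algebraMap D L), map_pow (algebraMap D L),
        map_pow (algebraMap D L)]
    refine ⟨Polynomial.monomial m (Polynomial.expand _ m g), ?_⟩
    change Polynomial.map (algebraMap D L) (Polynomial.monomial m _) = Θ x
    rw [scaledHom_of_isHomogeneous c φ hx1, Polynomial.map_monomial, hφx, ← mul_assoc, ← pow_mul,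
      mul_comm m, pow_mul, ← mul_pow, inv_mul_cancel₀ (pow_ne_zero _ hτ), one_pow, one_mul]
  obtain ⟨y, hy⟩ := coeff_mem_range_of_isIntegral (D := D) (L := L) (productAlgebra K V)
    (Θ : MvPolynomial (Fin n) K →+* Polynomial L) hΘ hf (m * k)
  have h1 : algebraMap D L (ρ (homogeneousComponent (m * k) f)) =
      algebraMap D L (Polynomial.X ^ (A.card * (m * k)) * y) := by
    rw [map_mul, hy, map_pow]
    change _ = τ ^ (A.card * (m * k)) * (scaledHom c φ f).coeff (m * k)
    rw [coeff_scaledHom, ← mul_assoc, pow_mul, ← mul_pow, mul_inv_cancel₀ (pow_ne_zero _ hτ),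
      one_pow, one_mul]
    rfl
  have h2 := IsFractionRing.injective D L h1
  rw [hρ] at h2
  rw [mem_spanIdeal_pow_iff hT, Polynomial.X_pow_dvd_iff]
  intro d hd
  rw [← Polynomial.coeff_expand_mul hm, h2, Polynomial.coeff_X_pow_mul', if_neg]
  rw [not_le]
  calc d * m < A.card * k * m := Nat.mul_lt_mul_of_pos_right hd hm
    _ = A.card * (m * k) := by ring

lemma mem_prod_pow_of_isIntegral [Infinite K]
    (V : Fin m → Submodule K (MvPolynomial (Fin n) K))
    (hV : ∀ i, V i ≤ homogeneousSubmodule (Fin n) K 1) {f : MvPolynomial (Fin n) K}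
    (hf : IsIntegral (productAlgebra K V) f) (k : ℕ) :
    homogeneousComponent (m * k) f ∈ (∏ i, V i) ^ k := by
  classical
  have hprod : ∏ p : Fin m × Fin k, V p.1 = (∏ i, V i) ^ k := by
    rw [Fintype.prod_prod_type]
    simp [Finset.prod_pow]
  rw [← hprod]
  refine mem_prod_of_forall_mem_spanIdeal_pow Finset.univ (fun p : Fin m × Fin k => V p.1)
    (fun p _ => hV p.1) ?_ fun A _ => ?_
  · simpa using homogeneousComponent_isHomogeneous (m * k) f
  · have h1 := homogeneousComponent_mem_spanIdeal_pow_of_isIntegral V hV hf (A.image Prod.fst) k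
    have h2 : sumSpace V (A.image Prod.fst) ≤ sumSpace (fun p : Fin m × Fin k => V p.1) A := by
      refine sumSpace_le fun i hi => ?_
      obtain ⟨p, hp, rfl⟩ := Finset.mem_image.1 hi
      exact le_sumSpace (fun p : Fin m × Fin k => V p.1) hp
    -- Each `V i` occurs `k` times, so only the set of first coordinates of `A` matters.
    have h3 : A.card ≤ (A.image Prod.fst).card * k := by
      calc A.card ≤ (A.image Prod.fst ×ˢ (Finset.univ : Finset (Fin k))).card :=
            Finset.card_le_card fun p hp =>
              Finset.mem_product.2 ⟨Finset.mem_image_of_mem _ hp, Finset.mem_univ _⟩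
        _ = _ := by simp
    exact Ideal.pow_le_pow_right h3 (Ideal.pow_right_mono (spanIdeal_mono h2) _ h1)

/-! ### The grading by degree modulo `m` -/

lemma weight_const_one {σ : Type*} (d : σ →₀ ℕ) :
    Finsupp.weight (fun _ : σ => (1 : ZMod m)) d = (d.degree : ZMod m) := by
  simp [Finsupp.weight_apply, Finsupp.sum, Finsupp.degree_apply]

lemma isWeightedHomogeneous_of_mem_productAlgebra
    (V : Fin m → Submodule K (MvPolynomial (Fin n) K))
    (hV : ∀ i, V i ≤ homogeneousSubmodule (Fin n) K 1) {f : MvPolynomial (Fin n) K}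
    (hf : f ∈ productAlgebra K V) : f.IsWeightedHomogeneous (fun _ => (1 : ZMod m)) 0 := by
  induction hf using Algebra.adjoin_induction with
  | mem x hx =>
    have hx1 : x.IsHomogeneous m := by
      simpa using prod_le_homogeneousSubmodule (s := Finset.univ) (fun i _ => hV i) hx
    intro d hd
    have : d.degree = m := by
      by_contra hne
      exact hd (hx1.coeff_eq_zero hne)
    rw [weight_const_one, this, ZMod.natCast_self]
  | algebraMap r => exact isWeightedHomogeneous_C _ r
  | add x y _ _ hx hy => exact hx.add hy
  | mul x y _ _ hx hy => simpa using hx.mul hy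

/-- In the `ZMod m`-grading both `b` and `b * f` have degree `0`, so `b` annihilates every other
component of `f`. For `m = 0` this is the `ℤ`-grading. -/
lemma homogeneousComponent_eq_zero_of_not_dvd
    (V : Fin m → Submodule K (MvPolynomial (Fin n) K))
    (hV : ∀ i, V i ≤ homogeneousSubmodule (Fin n) K 1) {f b : MvPolynomial (Fin n) K}
    (hb : b ∈ productAlgebra K V) (hb0 : b ≠ 0) (hbf : b * f ∈ productAlgebra K V) {d : ℕ}
    (hd : ¬ m ∣ d) : homogeneousComponent d f = 0 := by
  let w : Fin n → ZMod m := fun _ => 1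
  let := weightedGradedAlgebra K w
  have hb' : b ∈ weightedHomogeneousSubmodule K w 0 :=
    isWeightedHomogeneous_of_mem_productAlgebra V hV hb
  have hbf' : b * f ∈ weightedHomogeneousSubmodule K w 0 :=
    isWeightedHomogeneous_of_mem_productAlgebra V hV hbf
  ext e
  rw [coeff_homogeneousComponent, coeff_zero, ite_eq_right_iff]
  intro he
  have hj : (d : ZMod m) ≠ 0 := by rwa [Ne, ZMod.natCast_eq_zero_iff]
  have h1 := DirectSum.coe_decompose_mul_of_left_mem_zero (weightedHomogeneousSubmodule K w)
    (b := f) (j := (d : ZMod m)) hb'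
  rw [DirectSum.decompose_of_mem_ne _ hbf' hj.symm, eq_comm, mul_eq_zero, or_iff_right hb0] at h1
  have h2 : (DirectSum.decompose (weightedHomogeneousSubmodule K w) f (d : ZMod m) :
      MvPolynomial (Fin n) K) = weightedHomogeneousComponent w (d : ZMod m) f :=
    weightedDecomposition.decompose'_apply K w f _
  rw [h2] at h1
  have h3 := congrArg (coeff e) h1
  rwa [coeff_weightedHomogeneousComponent, if_pos (by rw [weight_const_one, he]), coeff_zero] at h3

lemma prod_pow_le_productAlgebra (V : Fin m → Submodule K (MvPolynomial (Fin n) K)) (k : ℕ) :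
    (∏ i, V i) ^ k ≤ (productAlgebra K V).toSubmodule := by
  induction k with
  | zero =>
    rw [pow_zero, Submodule.one_le]
    exact one_mem (productAlgebra K V)
  | succ k ih =>
    rw [pow_succ, Submodule.mul_le]
    exact fun x hx y hy => mul_mem (S := Subalgebra K _) (ih hx) (Algebra.subset_adjoin hy)

theorem mem_productAlgebra_of_isIntegral [Infinite K]
    (V : Fin m → Submodule K (MvPolynomial (Fin n) K))
    (hV : ∀ i, V i ≤ homogeneousSubmodule (Fin n) K 1) {f b : MvPolynomial (Fin n) K}
    (hb : b ∈ productAlgebra K V) (hb0 : b ≠ 0) (hbf : b * f ∈ productAlgebra K V)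
    (hf : IsIntegral (productAlgebra K V) f) : f ∈ productAlgebra K V := by
  rw [← sum_homogeneousComponent f]
  refine sum_mem fun d _ => ?_
  by_cases hd : m ∣ d
  · obtain ⟨k, rfl⟩ := hd
    exact prod_pow_le_productAlgebra V k (mem_prod_pow_of_isIntegral V hV hf k)
  · rw [homogeneousComponent_eq_zero_of_not_dvd V hV hb hb0 hbf hd]
    exact zero_mem _

/-- A subalgebra of an integrally closed domain `B` is integrally closed as soon as it contains
the elements of `B` that are integral over it and lie in its field of fractions. -/
lemma isIntegrallyClosed_of_forall_mem {B : Type*} [CommRing B] [IsDomain B]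
    [IsIntegrallyClosed B] [Algebra K B] (A : Subalgebra K B)
    (h : ∀ f : B, IsIntegral A f → ∀ b ∈ A, b ≠ 0 → b * f ∈ A → f ∈ A) :
    IsIntegrallyClosed A := by
  rw [isIntegrallyClosed_iff (FractionRing A)]
  intro x hx
  obtain ⟨a, b, hb, rfl⟩ := IsFractionRing.div_surjective (A := A) x
  have hb0 : b ≠ 0 := nonZeroDivisors.ne_zero hb
  let ι : FractionRing A →ₐ[A] FractionRing B :=
    IsFractionRing.liftAlgHom (g := Algebra.ofId A (FractionRing B)) (by
      intro p q hpq
      rw [Algebra.ofId_apply, Algebra.ofId_apply, IsScalarTower.algebraMap_apply A B,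
        IsScalarTower.algebraMap_apply A B] at hpq
      exact Subtype.val_injective (IsFractionRing.injective B (FractionRing B) hpq))
  have h1 : IsIntegral A (ι (algebraMap A _ a / algebraMap A _ b)) := hx.map ι
  -- The fraction is integral over `B` too, so it comes from some `f` in `B`.
  obtain ⟨f, hf⟩ := IsIntegrallyClosed.algebraMap_eq_of_integral (R := B) (h1.tower_top)
  rw [← hf] at h1
  have hfint : IsIntegral A f :=
    (isIntegral_algebraMap_iff (IsFractionRing.injective B (FractionRing B))).1 h1
  have hb0' : algebraMap A (FractionRing A) b ≠ 0 := by simpa using hb0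
  have hbf : (b : B) * f = a := by
    apply IsFractionRing.injective B (FractionRing B)
    rw [map_mul, hf]
    change algebraMap A (FractionRing B) b * _ = algebraMap A (FractionRing B) a
    rw [← ι.commutes, ← ι.commutes, ← map_mul, mul_div_cancel₀ _ hb0']
  have hfA : f ∈ A := h f hfint b b.2 (by simpa using hb0) (hbf ▸ a.2)
  refine ⟨⟨f, hfA⟩, ?_⟩
  rw [eq_div_iff hb0', ← map_mul]
  congr 1
  exact Subtype.ext (by rw [← hbf, mul_comm]; rfl)

end Integral

end LinearProducts

theorem theorem2p2 {K : Type*} [Field K] [Infinite K] {n m : ℕ}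
    (V : Fin m → Submodule K (MvPolynomial (Fin n) K))
    (hV : ∀ i, V i ≤ MvPolynomial.homogeneousSubmodule (Fin n) K 1) :
    IsDomain (productAlgebra K V) ∧ IsIntegrallyClosed (productAlgebra K V) :=
  ⟨inferInstance, LinearProducts.isIntegrallyClosed_of_forall_mem _ fun _ hf _ hb hb0 hbf =>
    LinearProducts.mem_productAlgebra_of_isIntegral V hV hb hb0 hbf hf⟩
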